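/- All graphs are finite and simple. The claw is $K_{1,3}$; $4K_1$ is the edgeless graph on four vertices; the bridge is the graph on six vertices $a,b,c_1,c_2,d_1,d_2$ with edges $ab$, $c_1c_2$, $d_1d_2$ and all eight edges joining $\{a,b\}$ to $\{c_1,c_2,d_1,d_2\}$; $C_7$ is the cycle on seven vertices. A graph is $(\text{claw},4K_1,\text{bridge})$-free if it contains none of these three graphs as an induced subgraph. The clique-width of a graph is the least number $k$ of labels with which it can be built by the operations: create a vertex with label $i$; take the disjoint union of two labelled graphs; change all labels $i$ to $j$; add all edges between vertices with label $i$ and vertices with label $j$ (for $i\neq j$). **Theorem.** There is an absolute constant $k$ such that every $(\text{claw},4K_1,\text{bridge})$-free graph $G$ that contains an induced $C_7$ has clique-width at most $k$. Moreover, let $H$ be any induced $C_7$ of such a graph $G$, with vertices $1,\dots,7$ in cyclic order (indices modulo $7$), and for each $i$ let $X_i$, $Y_i$, $Z_i$ be the sets of the vertices outside $H$ whose set of neighbours on $H$ is exactly $\{i,i+1,i+2\}$, exactly $\{i,i+1,i+2,i+3\}$, and exactly $\{i,i+1,i+3,i+4\}$, respectively. Then these $21$ sets are pairwise disjoint cliques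 (possibly empty) whose union is $V(G)\setminus V(H)$, and $|Z_i|\le 1$ for every $i$. -/

import Mathlib

open scoped SimpleGraph

/-- Terms built from the four clique-width operations with labels in `Fin k`.
A join `η_{i,j}` is only formed for distinct labels, as usual. -/
inductive KExpr (k : ℕ) : Type where
  | vertex (i : Fin k) : KExpr k
  | union (s t : KExpr k) : KExpr k
  | relabel (i j : Fin k) (t : KExpr k) : KExpr k
  | join (i j : Fin k) (hij : i ≠ j) (t : KExpr k) : KExpr k

namespace KExpr

variable {k : ℕ}

/-- The vertices of the graph defined by a term: one for each vertex creation in it. -/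
abbrev Vert : KExpr k → Type
  | vertex _ => Unit
  | union s t => Vert s ⊕ Vert t
  | relabel _ _ t => Vert t
  | join _ _ _ t => Vert t

/-- The current label of each vertex. -/
def label : (t : KExpr k) → t.Vert → Fin k
  | vertex i => fun _ => i
  | union s t => Sum.elim (label s) (label t)
  | relabel i j t => fun v => if label t v = i then j else label t v
  | join _ _ _ t => label t

/-- The graph defined by a term. -/
def graph : (t : KExpr k) → SimpleGraph t.Vert
  | vertex _ => (⊥ : SimpleGraph Unit)
  | union s t => graph s ⊕g graph t
  | relabel _ _ t => graph t
  | join i j _ t =>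
      graph t ⊔ SimpleGraph.fromRel (fun u v => label t u = i ∧ label t v = j)

end KExpr

/-- The clique-width of `G`: the least `k` such that some `k`-expression defines `G` up to
isomorphism (`⊤` if there is none). Every finite nonempty graph has a `k`-expression for
some `k`. -/
noncomputable def cliqueWidth {V : Type*} (G : SimpleGraph V) : ℕ∞ :=
  ⨅ (k : ℕ) (_ : ∃ t : KExpr k, Nonempty (t.graph ≃g G)), (k : ℕ∞)

/-- The claw `K_{1,3}`. -/
def claw : SimpleGraph (Fin 1 ⊕ Fin 3) := completeBipartiteGraph (Fin 1) (Fin 3)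

/-- `4K₁`, the stable set on four vertices. -/
def fourK1 : SimpleGraph (Fin 4) := ⊥

/-- The bridge: two adjacent vertices `0` and `1`, both adjacent to each end of the two disjoint
edges `23` and `45`, and no further edges. -/
def bridgeGraph : SimpleGraph (Fin 6) :=
  SimpleGraph.fromEdgeSet {s(0, 1), s(0, 2), s(0, 3), s(0, 4), s(0, 5),
    s(1, 2), s(1, 3), s(1, 4), s(1, 5), s(2, 3), s(4, 5)}

section Hole

variable {V : Type*} {G : SimpleGraph V}

/-- The vertices outside the induced 7-cycle `φ` whose neighbours on it are precisely those with
index in `S`. -/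
def holeClass (φ : SimpleGraph.cycleGraph 7 ↪g G) (S : Set (Fin 7)) : Set V :=
  {v | v ∉ Set.range φ ∧ ∀ j, G.Adj v (φ j) ↔ j ∈ S}

/-- `X_i`: the neighbours on the hole are `i, i+1, i+2` (indices modulo 7). -/
def holeX (φ : SimpleGraph.cycleGraph 7 ↪g G) (i : Fin 7) : Set V :=
  holeClass φ {i, i + 1, i + 2}

/-- `Y_i`: the neighbours on the hole are `i, i+1, i+2, i+3`. -/
def holeY (φ : SimpleGraph.cycleGraph 7 ↪g G) (i : Fin 7) : Set V :=
  holeClass φ {i, i + 1, i + 2, i + 3}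

/-- `Z_i`: the neighbours on the hole are `i, i+1, i+3, i+4`. -/
def holeZ (φ : SimpleGraph.cycleGraph 7 ↪g G) (i : Fin 7) : Set V :=
  holeClass φ {i, i + 1, i + 3, i + 4}

/-- The family of the 21 sets `X_i`, `Y_i`, `Z_i`. -/
def holePiece (φ : SimpleGraph.cycleGraph 7 ↪g G) : Fin 7 ⊕ Fin 7 ⊕ Fin 7 → Set V :=
  Sum.elim (holeX φ) (Sum.elim (holeY φ) (holeZ φ))

end Hole

/-! Three families of small checks on the hole drive the proof. A vertex outside it has no stable
triple of the hole among its neighbours (claw) or its non-neighbours (`4K₁`), and no neighbour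
isolated among its neighbours on the hole (claw); only the 21 listed supports survive. Each piece is
a clique by claw-freeness, and two vertices of `Z_i` form a bridge with two hole edges.

Call a piece `X_i` or `Y_i` large if it has at least four vertices. At most 7 + 21 · 3 = 70 vertices
lie outside the large pieces. Between large pieces adjacency follows the fixed pattern `Full`, and
all deviations from it together form a matching (`eq_of_residual`). The threshold four comes from
`ncard_le_three_of_rows`: two vertices of one piece sort another piece into four adjacency patterns,
and under suitable hole conditions bridge-freeness forbids one pattern and allows each other at most
once.

Such a graph has bounded clique-width (`exists_bound_cliqueWidth`): colour each vertex by its piece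
and its neighbours among the exceptional vertices, give each exceptional vertex its own colour, and
insert matched vertices in pairs. -/

/-! ### Clique-width of blow-ups up to a matching -/

section CliqueWidth

variable {V : Type*} {k : ℕ}

/-- Some term defines the subgraph of `G` induced on `W`, with the labels given by `l`. -/
def Builds (G : SimpleGraph V) (W : Set V) (l : V → Fin k) : Prop :=
  ∃ (t : KExpr k) (f : t.Vert → V), Function.Injective f ∧ Set.range f = W ∧
    (∀ x y, t.graph.Adj x y ↔ G.Adj (f x) (f y)) ∧ ∀ x, t.label x = l (f x)

namespace Builds

variable {G H : SimpleGraph V} {W : Set V} {l m : V → Fin k}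

theorem congr (h : Builds G W l) (hG : ∀ x ∈ W, ∀ y ∈ W, G.Adj x y ↔ H.Adj x y)
    (hl : ∀ x ∈ W, l x = m x) : Builds H W m := by
  obtain ⟨t, f, hf, rfl, ha, hb⟩ := h
  exact ⟨t, f, hf, rfl, fun x y => (ha x y).trans (hG _ ⟨x, rfl⟩ _ ⟨y, rfl⟩),
    fun x => (hb x).trans (hl _ ⟨x, rfl⟩)⟩

theorem singleton (v : V) : Builds G {v} l :=
  ⟨.vertex (l v), fun _ => v, fun _ _ _ => rfl, Set.range_const,
    fun _ _ => by simp [KExpr.graph], fun _ => rfl⟩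

theorem relabel (h : Builds G W l) (i j : Fin k) :
    Builds G W (fun v => if l v = i then j else l v) := by
  obtain ⟨t, f, hf, hW, ha, hb⟩ := h
  exact ⟨.relabel i j t, f, hf, hW, ha, fun x => by simp only [KExpr.label]; rw [hb x]⟩

theorem join (h : Builds G W l) {i j : Fin k} (hij : i ≠ j) :
    Builds (G ⊔ SimpleGraph.fromRel (fun u v => l u = i ∧ l v = j)) W l := by
  obtain ⟨t, f, hf, hW, ha, hb⟩ := h
  refine ⟨.join i j hij t, f, hf, hW, fun x y => ?_, hb⟩
  simp only [KExpr.graph, SimpleGraph.sup_adj, SimpleGraph.fromRel_adj, ha, hb, hf.ne_iff]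

theorem insert_isolated (h : Builds G W l) {v : V} (hv : v ∉ W) (hG : ∀ w ∈ W, ¬ G.Adj v w) :
    Builds G (insert v W) l := by
  obtain ⟨t, f, hf, hW, ha, hb⟩ := h
  have hfv : ∀ x, f x ≠ v := fun x hx => hv (hW ▸ ⟨x, hx⟩)
  have hfG : ∀ x, ¬ G.Adj v (f x) := fun x => hG _ (hW ▸ ⟨x, rfl⟩)
  refine ⟨.union (.vertex (l v)) t, Sum.elim (fun _ => v) f, ?_, ?_, ?_, ?_⟩
  · exact Function.Injective.sumElim (fun _ _ _ => rfl) hf fun _ x => (hfv x).symm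
  · rw [Set.Sum.elim_range, hW, Set.range_const, Set.singleton_union]
  · rintro (x | x) (y | y)
    · simp [KExpr.graph]
    · simp [KExpr.graph, hfG]
    · simpa [KExpr.graph] using fun h => hfG x h.symm
    · simp [KExpr.graph, ha]
  · rintro (x | x)
    · rfl
    · exact hb x

/-- Adding a vertex with a fresh label whose neighbours are the vertices with label in `J`. -/
theorem insert_fresh (h : W = ∅ ∨ Builds G W l) {v : V} (hv : v ∉ W) {p : Fin k}
    (hp : ∀ w ∈ W, l w ≠ p) (J : Finset (Fin k)) (hJ : ∀ w ∈ W, G.Adj v w ↔ l w ∈ J)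
    [DecidableEq V] : Builds G (insert v W) (Function.update l v p) := by
  rcases h with rfl | h
  · simpa using singleton v
  have hne : ∀ w ∈ W, w ≠ v := fun w hw hwv => hv (hwv ▸ hw)
  -- Only `v` carries label `p`, so each join of `p` with a label `j` adds just the edges from `v`
  -- to label `j`.
  have key : ∀ I : Finset (Fin k), p ∉ I → Builds (SimpleGraph.fromRel fun x y =>
      (x ∈ W ∧ y ∈ W ∧ G.Adj x y) ∨ (x = v ∧ y ∈ W ∧ l y ∈ I)) (insert v W)
      (Function.update l v p) := by
    intro I
    induction I using Finset.induction_on with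
    | empty =>
      intro _
      refine insert_isolated (h.congr ?_ ?_) hv ?_
      · intro x hx y hy
        simp only [SimpleGraph.fromRel_adj, hx, hy, true_and, Finset.notMem_empty, and_false,
          or_false, G.adj_comm y x, or_self]
        exact ⟨fun h => ⟨h.ne, h⟩, And.right⟩
      · intro x hx
        rw [Function.update_of_ne (hne x hx)]
      · intro w hw
        simp [hv]
    | insert j I hj ih =>
      intro hpI
      rw [Finset.mem_insert, not_or] at hpI
      refine ((ih hpI.2).join hpI.1).congr ?_ fun _ _ => rfl
      rintro x (rfl | hx) y (rfl | hy)
      · simp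
      · simp [hne y hy, (hne y hy).symm, hy, hv, hpI.1, hp y hy]
        tauto
      · simp [hne x hx, hx, hv, hpI.1, hp x hx]
        tauto
      · simp [hne x hx, hne y hy, hp x hx, hp y hy]
  -- A join needs distinct labels; dropping `p` is harmless because no vertex of `W` carries it.
  refine (key (J.erase p) (Finset.notMem_erase _ _)).congr ?_ fun _ _ => rfl
  rintro x (rfl | hx) y (rfl | hy)
  · simp
  · simp [hne y hy, (hne y hy).symm, hy, hv, hp y hy, hJ y hy]
  · simp [hne x hx, hx, hv, hp x hx, G.adj_comm x, hJ x hx]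
  · simp only [SimpleGraph.fromRel_adj, hx, hy, hne x hx, hne y hy, true_and, false_and,
      or_false, G.adj_comm y x, or_self]
    exact ⟨And.right, fun h => ⟨h.ne, h⟩⟩

theorem cliqueWidth_le (h : Builds G Set.univ l) : cliqueWidth G ≤ k := by
  obtain ⟨t, f, hf, hW, ha, -⟩ := h
  exact iInf₂_le k ⟨t, ⟨⟨Equiv.ofBijective f ⟨hf, Set.range_eq_univ.1 hW⟩, (ha _ _).symm⟩⟩⟩

end Builds

/-- If the adjacency of two distinct vertices that are not matched by `M` depends only on their
colours, then the clique-width is at most the number of colours plus two. -/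
theorem cliqueWidth_le_of_matching [Finite V] [Nonempty V] {L : Type*} [Fintype L]
    (G : SimpleGraph V) (c : V → L) (M : V → V → Prop) (hirr : ∀ v, ¬ M v v)
    (hsymm : ∀ u v, M u v → M v u) (huniq : ∀ u v w, M u v → M u w → v = w)
    (hc : ∀ u v u' v', u ≠ v → u' ≠ v' → c u = c u' → c v = c v' → ¬ M u v → ¬ M u' v' →
      G.Adj u v → G.Adj u' v') :
    cliqueWidth G ≤ (Fintype.card L + 2 : ℕ) := by
  classical
  -- The two extra labels hold a new vertex and its partner until both are relabelled to their
  -- colours.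
  let e : L ⊕ Bool ≃ Fin (Fintype.card L + 2) := Fintype.equivFinOfCardEq (by simp)
  let l : V → Fin (Fintype.card L + 2) := fun v => e (.inl (c v))
  have hl : ∀ w b, l w ≠ e (.inr b) := fun w b h => by simpa using e.injective h
  let J : Set V → V → Finset (Fin (Fintype.card L + 2)) := fun W v =>
    Finset.univ.filter fun a => ∃ w ∈ W, l w = a ∧ G.Adj v w
  have hJ : ∀ W v, v ∉ W → (∀ w ∈ W, ¬ M v w) → ∀ w ∈ W, (G.Adj v w ↔ l w ∈ J W v) := by
    intro W v hv hM w hw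
    simp only [J, Finset.mem_filter, Finset.mem_univ, true_and]
    refine ⟨fun h => ⟨w, hw, rfl, h⟩, ?_⟩
    rintro ⟨w', hw', hww, h⟩
    refine hc v w' v w ?_ ?_ rfl ?_ (hM _ hw') (hM _ hw) h
    · rintro rfl; exact hv hw'
    · rintro rfl; exact hv hw
    · simpa using e.injective hww
  -- `W` stays closed under `M`, so a vertex outside it is matched to nothing inside and its
  -- neighbours in `W` are determined by colour. The empty set is separate because every term has a
  -- vertex.
  have key : ∀ T : Finset V, ∃ W : Set V, ↑T ⊆ W ∧ (∀ u ∈ W, ∀ v, M u v → v ∈ W) ∧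
      (W = ∅ ∨ Builds G W l) := by
    intro T
    induction T using Finset.induction_on with
    | empty => exact ⟨∅, by simp, by simp, .inl rfl⟩
    | insert v T _ ih =>
      obtain ⟨W, hTW, hsat, hW⟩ := ih
      by_cases hv : v ∈ W
      · exact ⟨W, by simpa [Set.insert_subset_iff] using ⟨hv, hTW⟩, hsat, hW⟩
      have hMW : ∀ u, u ∉ W → ∀ w ∈ W, ¬ M u w := fun u hu w hw h => hu (hsat w hw u (hsymm _ _ h))
      have h1 := Builds.insert_fresh hW hv (p := e (.inr false)) (fun w _ => hl w _) (J W v)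
        (hJ W v hv (hMW v hv))
      by_cases hu : ∃ u, M v u
      · obtain ⟨u, hvu⟩ := hu
        have huv : u ≠ v := by rintro rfl; exact hirr _ hvu
        have huW : u ∉ W := fun h => hv (hsat u h v (hsymm _ _ hvu))
        have h2 := Builds.insert_fresh (.inr h1) (v := u) (by simp [huv, huW])
          (p := e (.inr true)) ?_ (J W u ∪ if G.Adj u v then {e (.inr false)} else ∅) ?_
        · refine ⟨insert u (insert v W), ?_, ?_, .inr ?_⟩
          · rw [Finset.coe_insert]
            exact (Set.insert_subset_insert hTW).trans (Set.subset_insert _ _)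
          · rintro x (rfl | rfl | hx) y hxy
            · rw [huniq _ _ _ hxy (hsymm _ _ hvu)]; simp
            · rw [huniq _ _ _ hxy hvu]; simp
            · exact .inr (.inr (hsat x hx y hxy))
          · refine ((h2.relabel (e (.inr true)) (l u)).relabel (e (.inr false)) (l v)).congr
              (fun _ _ _ _ => Iff.rfl) ?_
            intro x _
            by_cases hxu : x = u
            · subst hxu; simp [hl]
            · by_cases hxv : x = v
              · subst hxv; simp [hxu]
              · simp [hxu, hxv, hl]
        · rintro w (rfl | hw)
          · simp
          · rw [Function.update_of_ne (by rintro rfl; exact hv hw)]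
            exact hl w _
        · rintro w (rfl | hw)
          · have : e (.inr false) ∉ J W u := by simp [J, hl]
            by_cases h : G.Adj u w <;> simp [h, this]
          · rw [Function.update_of_ne (by rintro rfl; exact hv hw), hJ W u huW (hMW u huW) w hw]
            by_cases h : G.Adj u v <;> simp [h, hl]
      · refine ⟨insert v W, ?_, ?_, .inr ?_⟩
        · rw [Finset.coe_insert]
          exact Set.insert_subset_insert hTW
        · rintro x (rfl | hx) y hxy
          · exact (hu ⟨y, hxy⟩).elim
          · exact .inr (hsat x hx y hxy)
        · refine (h1.relabel (e (.inr false)) (l v)).congr (fun _ _ _ _ => Iff.rfl) ?_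
          intro x _
          by_cases hxv : x = v
          · subst hxv; simp
          · simp [hxv, hl]
  have := Fintype.ofFinite V
  obtain ⟨W, hTW, -, hW⟩ := key Finset.univ
  rw [Finset.coe_univ, Set.univ_subset_iff] at hTW
  subst hTW
  rcases hW with h | h
  · exact (Set.univ_nonempty.ne_empty h).elim
  · exact h.cliqueWidth_le

/-- Bounded clique-width for graphs that become blow-ups up to a matching after removing
at most `N` vertices. -/
theorem exists_bound_cliqueWidth (N : ℕ) (I : Type) [Finite I] : ∃ k : ℕ,
    ∀ (V : Type*) [Finite V] [Nonempty V] (G : SimpleGraph V) (S : Set V) (cls : V → I)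
      (F : I → I → Prop), S.ncard ≤ N →
      (∀ u ∉ S, ∀ v ∉ S, ∀ w ∉ S, u ≠ v → u ≠ w → ¬ (G.Adj u v ↔ F (cls u) (cls v)) →
        ¬ (G.Adj u w ↔ F (cls u) (cls w)) → v = w) → (∀ i j, F i j → F j i) →
      cliqueWidth G ≤ k := by
  classical
  have := Fintype.ofFinite I
  refine ⟨Fintype.card (Fin N ⊕ (I × Set (Fin N))) + 2, ?_⟩
  intro V _ _ G S cls F hS hM hF
  have := Fintype.ofFinite S
  have hcard : Fintype.card S ≤ Fintype.card (Fin N) := by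
    rwa [Fintype.card_fin, ← Nat.card_eq_fintype_card, Nat.card_coe_set_eq]
  obtain ⟨e⟩ := Function.Embedding.nonempty_of_card_le hcard
  have hFc : ∀ i j, F i j ↔ F j i := fun i j => ⟨hF i j, hF j i⟩
  refine cliqueWidth_le_of_matching G (fun v => if h : v ∈ S then .inl (e ⟨v, h⟩) else
    .inr (cls v, {n | ∃ s : S, e s = n ∧ G.Adj v s}))
    (fun u v => u ∉ S ∧ v ∉ S ∧ u ≠ v ∧ ¬ (G.Adj u v ↔ F (cls u) (cls v))) ?_ ?_ ?_ ?_
  · simp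
  · rintro u v ⟨hu, hv, huv, h⟩
    exact ⟨hv, hu, huv.symm, by rwa [G.adj_comm, hFc]⟩
  · rintro u v w ⟨hu, hv, huv, h⟩ ⟨-, hw, huw, h'⟩
    exact hM u hu v hv w hw huv huw h h'
  · intro u v u' v' huv huv' hu hv hMM hMM' hadj
    have aux : ∀ {x x' : V}, x ∉ S → x' ∉ S →
        {n | ∃ s : S, e s = n ∧ G.Adj x s} = {n | ∃ s : S, e s = n ∧ G.Adj x' s} →
        ∀ s ∈ S, G.Adj x s → G.Adj x' s := by
      intro x x' _ _ h s hs hxs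
      have h1 : e ⟨s, hs⟩ ∈ {n | ∃ s : S, e s = n ∧ G.Adj x s} := ⟨_, rfl, hxs⟩
      rw [h] at h1
      obtain ⟨s', hs', h2⟩ := h1
      rw [e.injective hs'] at h2
      exact h2
    by_cases huS : u ∈ S <;> by_cases huS' : u' ∈ S <;> simp only [huS, huS', dite_true,
      dite_false, Sum.inl.injEq, Sum.inr.injEq, reduceCtorEq, e.injective.eq_iff,
      Subtype.mk.injEq, Prod.mk.injEq] at hu <;>
    by_cases hvS : v ∈ S <;> by_cases hvS' : v' ∈ S <;> simp only [hvS, hvS', dite_true,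
      dite_false, Sum.inl.injEq, Sum.inr.injEq, reduceCtorEq, e.injective.eq_iff,
      Subtype.mk.injEq, Prod.mk.injEq] at hv
    · rwa [← hu, ← hv]
    · rw [← hu]
      exact (aux hvS hvS' hv.2 u huS hadj.symm).symm
    · rw [← hv]
      exact aux huS huS' hu.2 v hvS hadj
    · simp only [huS, hvS, huS', hvS', not_false_eq_true, true_and, not_and, not_not] at hMM hMM'
      rw [hMM' huv', ← hu.1, ← hv.1, ← hMM huv]
      exact hadj

end CliqueWidth

/-! ### Recognising the forbidden subgraphs -/

section InducedSubgraphs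

variable {V : Type*} {G : SimpleGraph V}

theorem isIndContained_of_forall_lt {α : Type*} [LinearOrder α] {H : SimpleGraph α} (f : α → V)
    (h : ∀ a b, a < b → f a ≠ f b ∧ (G.Adj (f a) (f b) ↔ H.Adj a b)) : H.IsIndContained G := by
  refine ⟨⟨⟨f, fun a b hab => ?_⟩, fun {a b} => ?_⟩⟩
  · rcases lt_trichotomy a b with hlt | rfl | hlt
    · exact ((h a b hlt).1 hab).elim
    · rfl
    · exact ((h b a hlt).1 hab.symm).elim
  · change G.Adj (f a) (f b) ↔ _
    rcases lt_trichotomy a b with hlt | rfl | hlt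
    · exact (h a b hlt).2
    · simp
    · rw [G.adj_comm, H.adj_comm]
      exact (h b a hlt).2

theorem claw_isIndContained {c x y z : V} (hx : G.Adj c x) (hy : G.Adj c y) (hz : G.Adj c z)
    (hxy : ¬ G.Adj x y) (hxz : ¬ G.Adj x z) (hyz : ¬ G.Adj y z) (nxy : x ≠ y) (nxz : x ≠ z)
    (nyz : y ≠ z) : claw.IsIndContained G := by
  -- The lexicographic order serves only to make the vertex type linearly ordered, so that each pair
  -- is checked once.
  refine isIndContained_of_forall_lt (α := Fin 1 ⊕ₗ Fin 3) (H := claw)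
    (Sum.elim (fun _ => c) ![x, y, z]) ?_
  rintro (a | a) (b | b) hab
  · exact (hab.ne (congrArg _ (Subsingleton.elim a b))).elim
  · fin_cases b
    · exact ⟨hx.ne, by simp [claw, hx]⟩
    · exact ⟨hy.ne, by simp [claw, hy]⟩
    · exact ⟨hz.ne, by simp [claw, hz]⟩
  · exact (Sum.Lex.not_inr_lt_inl hab).elim
  · fin_cases a <;> fin_cases b
    on_goal 2 => exact ⟨nxy, by simp [claw, hxy]⟩
    on_goal 2 => exact ⟨nxz, by simp [claw, hxz]⟩
    on_goal 4 => exact ⟨nyz, by simp [claw, hyz]⟩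
    all_goals exact absurd (Sum.Lex.inr_lt_inr_iff.1 hab) (by decide)

theorem fourK1_isIndContained {w x y z : V} (hwx : ¬ G.Adj w x) (hwy : ¬ G.Adj w y)
    (hwz : ¬ G.Adj w z) (hxy : ¬ G.Adj x y) (hxz : ¬ G.Adj x z) (hyz : ¬ G.Adj y z)
    (nwx : w ≠ x) (nwy : w ≠ y) (nwz : w ≠ z) (nxy : x ≠ y) (nxz : x ≠ z) (nyz : y ≠ z) :
    fourK1.IsIndContained G := by
  refine isIndContained_of_forall_lt ![w, x, y, z] ?_
  simp [Fin.forall_fin_succ, fourK1, hwx, hwy, hwz, hxy, hxz, hyz, nwx, nwy, nwz, nxy, nxz, nyz]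

theorem bridge_isIndContained {a b c d e f : V} (hab : G.Adj a b) (hac : G.Adj a c)
    (had : G.Adj a d) (hae : G.Adj a e) (haf : G.Adj a f) (hbc : G.Adj b c) (hbd : G.Adj b d)
    (hbe : G.Adj b e) (hbf : G.Adj b f) (hcd : G.Adj c d) (hef : G.Adj e f)
    (hce : ¬ G.Adj c e) (hcf : ¬ G.Adj c f) (hde : ¬ G.Adj d e) (hdf : ¬ G.Adj d f) :
    bridgeGraph.IsIndContained G := by
  have nce : c ≠ e := by rintro rfl; exact hcf hef
  have ncf : c ≠ f := by rintro rfl; exact hce hef.symm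
  have nde : d ≠ e := by rintro rfl; exact hdf hef
  have ndf : d ≠ f := by rintro rfl; exact hde hef.symm
  have hB : ∀ x y, x < y → (bridgeGraph.Adj x y ↔
      x = 0 ∨ x = 1 ∨ x = 2 ∧ y = 3 ∨ x = 4 ∧ y = 5) := by
    simp only [bridgeGraph, SimpleGraph.fromEdgeSet_adj, Set.mem_insert_iff,
      Set.mem_singleton_iff]
    decide
  refine isIndContained_of_forall_lt ![a, b, c, d, e, f] fun x y hxy => ?_
  rw [hB x y hxy]
  revert x y
  simp [Fin.forall_fin_succ, hab, hac, had, hae, haf, hbc, hbd, hbe, hbf, hcd, hef, hce, hcf, hde,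
    hdf, hab.ne, hac.ne, had.ne, hae.ne, haf.ne, hbc.ne, hbd.ne, hbe.ne, hbf.ne, hcd.ne, hef.ne,
    nce, ncf, nde, ndf]

end InducedSubgraphs

/-! ### Conditions on two supports, and the adjacencies they force -/

/-- Adjacency in the seven-cycle. -/
def NextTo (i j : Fin 7) : Prop := j = i + 1 ∨ i = j + 1

instance : DecidableRel NextTo := fun i j => inferInstanceAs (Decidable (j = i + 1 ∨ i = j + 1))

/-- The hole condition of `not_distinguished`. -/
def Distinguishes (A B : Finset (Fin 7)) : Prop :=
  ∃ d e, d ∈ A ∧ d ∈ B ∧ e ∈ B ∧ e ∉ A ∧ NextTo d e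

instance : DecidableRel Distinguishes := fun A B => by unfold Distinguishes; infer_instance

/-- The hole condition of `not_adj_of_private_neighbors`. -/
def PrivatePair (A B : Finset (Fin 7)) : Prop :=
  ∃ d e, d ∈ A ∧ d ∉ B ∧ e ∈ A ∧ e ∉ B ∧ d ≠ e ∧ ¬ NextTo d e

/-- The hole condition of `not_both_full`. -/
def PrivateEdge (A B : Finset (Fin 7)) : Prop :=
  ∃ d e, d ∈ A ∧ d ∉ B ∧ e ∈ A ∧ e ∉ B ∧ NextTo d e

/-- The hole condition of `not_both_empty`. -/
def CommonEdge (A B : Finset (Fin 7)) : Prop :=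
  ∃ d e, d ∈ A ∧ d ∈ B ∧ e ∈ A ∧ e ∈ B ∧ NextTo d e

/-- The hole conditions under which one of the two classes has at most three vertices. -/
def Exclusive (A B : Finset (Fin 7)) : Prop :=
  Distinguishes A B ∧ CommonEdge A B ∧
    ∃ d e f, d ∈ A ∧ d ∈ B ∧ e ∈ B ∧ e ∉ A ∧ f ∈ B ∧ f ∉ A ∧ NextTo e f ∧ ¬ NextTo d e ∧
      ¬ NextTo d f

instance : DecidableRel PrivatePair := fun A B => by unfold PrivatePair; infer_instance
instance : DecidableRel PrivateEdge := fun A B => by unfold PrivateEdge; infer_instance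
instance : DecidableRel CommonEdge := fun A B => by unfold CommonEdge; infer_instance
instance : DecidableRel Exclusive := fun A B => by unfold Exclusive; infer_instance

section Hole

variable {V : Type*} {G : SimpleGraph V} (φ : SimpleGraph.cycleGraph 7 ↪g G)

theorem hole_adj (i j : Fin 7) : G.Adj (φ i) (φ j) ↔ NextTo i j := by
  rw [φ.map_adj_iff]
  revert i j
  decide

variable {φ} {A B : Finset (Fin 7)} {a a' b b' : V}

theorem holeClass_adj (ha : a ∈ holeClass φ (A : Set (Fin 7))) {d : Fin 7} (hd : d ∈ A) :
    G.Adj (φ d) a :=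
  ((ha.2 d).2 hd).symm

theorem holeClass_not_adj (ha : a ∈ holeClass φ (A : Set (Fin 7))) {d : Fin 7} (hd : d ∉ A) :
    ¬ G.Adj (φ d) a :=
  fun h => hd ((ha.2 d).1 h.symm)

theorem holeClass_ne (ha : a ∈ holeClass φ (A : Set (Fin 7))) (d : Fin 7) : φ d ≠ a :=
  fun h => ha.1 ⟨d, h⟩

/-- Vertices missing two common nonadjacent hole vertices are adjacent. -/
theorem adj_of_common_nonneighbors (h4 : ¬ fourK1.IsIndContained G)
    (ha : a ∈ holeClass φ (A : Set (Fin 7))) (hb : b ∈ holeClass φ (B : Set (Fin 7)))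
    (hab : a ≠ b) (h : ∃ d e, d ∉ A ∧ d ∉ B ∧ e ∉ A ∧ e ∉ B ∧ d ≠ e ∧ ¬ NextTo d e) :
    G.Adj a b := by
  obtain ⟨d, e, hdA, hdB, heA, heB, hde, hn⟩ := h
  by_contra hadj
  exact h4 (fourK1_isIndContained (mt (hole_adj φ d e).1 hn) (holeClass_not_adj ha hdA)
    (holeClass_not_adj hb hdB) (holeClass_not_adj ha heA) (holeClass_not_adj hb heB) hadj
    (φ.injective.ne hde) (holeClass_ne ha d) (holeClass_ne hb d) (holeClass_ne ha e)
    (holeClass_ne hb e) hab)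

theorem adj_of_same_class (hclaw : ¬ claw.IsIndContained G)
    (ha : a ∈ holeClass φ (A : Set (Fin 7))) (hb : b ∈ holeClass φ (A : Set (Fin 7)))
    (hab : a ≠ b) (h : ∃ d e, d ∈ A ∧ e ∉ A ∧ NextTo d e) : G.Adj a b := by
  obtain ⟨d, e, hd, he, hde⟩ := h
  by_contra hadj
  exact hclaw (claw_isIndContained ((hole_adj φ d e).2 hde) (holeClass_adj ha hd)
    (holeClass_adj hb hd) (holeClass_not_adj ha he) (holeClass_not_adj hb he) hadj
    (holeClass_ne ha e) (holeClass_ne hb e) hab)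

/-- Otherwise `a` is the centre of a claw with leaves `φ d`, `φ e`, `b`. -/
theorem not_adj_of_private_neighbors (hclaw : ¬ claw.IsIndContained G)
    (ha : a ∈ holeClass φ (A : Set (Fin 7))) (hb : b ∈ holeClass φ (B : Set (Fin 7)))
    (h : PrivatePair A B) : ¬ G.Adj a b := by
  obtain ⟨d, e, hdA, hdB, heA, heB, hde, hn⟩ := h
  intro hadj
  exact hclaw (claw_isIndContained (holeClass_adj ha hdA).symm (holeClass_adj ha heA).symm hadj
    (mt (hole_adj φ d e).1 hn) (holeClass_not_adj hb hdB) (holeClass_not_adj hb heB)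
    (φ.injective.ne hde) (holeClass_ne hb d) (holeClass_ne hb e))

theorem not_adj_of_star {C : Finset (Fin 7)} {c : V} (hclaw : ¬ claw.IsIndContained G)
    (ha : a ∈ holeClass φ (A : Set (Fin 7))) (hb : b ∈ holeClass φ (B : Set (Fin 7)))
    (hc : c ∈ holeClass φ (C : Set (Fin 7))) (hbc : b ≠ c) (hnbc : ¬ G.Adj b c)
    (h : ∃ d, d ∈ A ∧ d ∉ B ∧ d ∉ C) (hab : G.Adj a b) : ¬ G.Adj a c := by
  obtain ⟨d, hdA, hdB, hdC⟩ := h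
  intro hac
  exact hclaw (claw_isIndContained (holeClass_adj ha hdA).symm hab hac (holeClass_not_adj hb hdB)
    (holeClass_not_adj hc hdC) hnbc (holeClass_ne hb d) (holeClass_ne hc d) hbc)

/-- Otherwise `b'` and `φ d` are the centres of a bridge with side edges `b (φ e)` and `a a'`. -/
theorem not_distinguished (hbr : ¬ bridgeGraph.IsIndContained G)
    (ha : a ∈ holeClass φ (A : Set (Fin 7))) (ha' : a' ∈ holeClass φ (A : Set (Fin 7)))
    (hb : b ∈ holeClass φ (B : Set (Fin 7))) (hb' : b' ∈ holeClass φ (B : Set (Fin 7)))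
    (haa : G.Adj a a') (hbb : G.Adj b b') (h : Distinguishes A B)
    (h1 : ¬ G.Adj a b) (h2 : G.Adj a b') (h3 : ¬ G.Adj a' b) : ¬ G.Adj a' b' := by
  obtain ⟨d, e, hdA, hdB, heB, heA, hde⟩ := h
  intro h4
  exact hbr (bridge_isIndContained (holeClass_adj hb' hdB).symm (holeClass_adj hb' heB).symm
    hbb.symm h2.symm h4.symm ((hole_adj φ d e).2 hde) (holeClass_adj hb hdB)
    (holeClass_adj ha hdA) (holeClass_adj ha' hdA) (holeClass_adj hb heB) haa
    (holeClass_not_adj ha heA) (holeClass_not_adj ha' heA) (fun h => h1 h.symm)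
    (fun h => h3 h.symm))

/-- The forbidden bridge has centres `φ d`, `φ e` and side edges `a a'`, `b b'`. -/
theorem not_both_empty (hbr : ¬ bridgeGraph.IsIndContained G)
    (ha : a ∈ holeClass φ (A : Set (Fin 7))) (ha' : a' ∈ holeClass φ (A : Set (Fin 7)))
    (hb : b ∈ holeClass φ (B : Set (Fin 7))) (hb' : b' ∈ holeClass φ (B : Set (Fin 7)))
    (haa : G.Adj a a') (hbb : G.Adj b b')
    (h : CommonEdge A B)
    (h1 : ¬ G.Adj a b) (h2 : ¬ G.Adj a b') (h3 : ¬ G.Adj a' b) : G.Adj a' b' := by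
  obtain ⟨d, e, hdA, hdB, heA, heB, hde⟩ := h
  by_contra h4
  exact hbr (bridge_isIndContained ((hole_adj φ d e).2 hde) (holeClass_adj ha hdA)
    (holeClass_adj ha' hdA) (holeClass_adj hb hdB) (holeClass_adj hb' hdB)
    (holeClass_adj ha heA) (holeClass_adj ha' heA) (holeClass_adj hb heB)
    (holeClass_adj hb' heB) haa hbb h1 h2 h3 h4)

/-- The forbidden bridge has centres `a`, `a'` and side edges `(φ d) (φ e)`, `b b'`. -/
theorem not_both_full (hbr : ¬ bridgeGraph.IsIndContained G)
    (ha : a ∈ holeClass φ (A : Set (Fin 7))) (ha' : a' ∈ holeClass φ (A : Set (Fin 7)))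
    (hb : b ∈ holeClass φ (B : Set (Fin 7))) (hb' : b' ∈ holeClass φ (B : Set (Fin 7)))
    (haa : G.Adj a a') (hbb : G.Adj b b')
    (h : PrivateEdge A B)
    (h1 : G.Adj a b) (h2 : G.Adj a b') (h3 : G.Adj a' b) : ¬ G.Adj a' b' := by
  obtain ⟨d, e, hdA, hdB, heA, heB, hde⟩ := h
  intro h4
  exact hbr (bridge_isIndContained haa (holeClass_adj ha hdA).symm (holeClass_adj ha heA).symm
    h1 h2 (holeClass_adj ha' hdA).symm (holeClass_adj ha' heA).symm h3 h4
    ((hole_adj φ d e).2 hde) hbb (holeClass_not_adj hb hdB) (holeClass_not_adj hb' hdB)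
    (holeClass_not_adj hb heB) (holeClass_not_adj hb' heB))

/-- The forbidden bridge has centres `b`, `b'` and side edges `a (φ d)`, `(φ e) (φ f)`. -/
theorem not_adj_both (hbr : ¬ bridgeGraph.IsIndContained G)
    (ha : a ∈ holeClass φ (A : Set (Fin 7)))
    (hb : b ∈ holeClass φ (B : Set (Fin 7))) (hb' : b' ∈ holeClass φ (B : Set (Fin 7)))
    (hbb : G.Adj b b')
    (h : Exclusive A B)
    (h1 : G.Adj a b) : ¬ G.Adj a b' := by
  obtain ⟨-, -, d, e, f, hdA, hdB, heB, heA, hfB, hfA, hef, hde, hdf⟩ := h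
  intro h2
  exact hbr (bridge_isIndContained hbb (holeClass_adj hb hdB).symm h1.symm
    (holeClass_adj hb heB).symm (holeClass_adj hb hfB).symm (holeClass_adj hb' hdB).symm h2.symm
    (holeClass_adj hb' heB).symm (holeClass_adj hb' hfB).symm (holeClass_adj ha hdA)
    ((hole_adj φ e f).2 hef) (mt (hole_adj φ d e).1 hde) (mt (hole_adj φ d f).1 hdf)
    (fun h => holeClass_not_adj ha heA h.symm) (fun h => holeClass_not_adj ha hfA h.symm))

end Hole

/-! ### Finite checks on supports -/

section Supports

/-- The neighbours on the hole of the vertices in `holePiece φ p`. -/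
def pieceSupport : Fin 7 ⊕ Fin 7 ⊕ Fin 7 → Finset (Fin 7)
  | .inl i => {i, i + 1, i + 2}
  | .inr (.inl i) => {i, i + 1, i + 2, i + 3}
  | .inr (.inr i) => {i, i + 1, i + 3, i + 4}

/-- The supports of the pieces `X_i` and `Y_i`. -/
def xySupport (p : Fin 7 ⊕ Fin 7) : Finset (Fin 7) := pieceSupport (p.map id .inl)

/-- Pairs of pieces between which all edges, up to a matching, are present. -/
def Full : Fin 7 ⊕ Fin 7 → Fin 7 ⊕ Fin 7 → Bool
  | .inl i, .inl j => j == i || j == i + 1 || i == j + 1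
  | .inr i, .inr j => j == i || j == i + 1 || i == j + 1
  | .inl i, .inr j => j == i || i == j + 1
  | .inr j, .inl i => j == i || i == j + 1

/-- Pairs of pieces between which the edges may deviate from `Full` by a matching. -/
def Linked : Fin 7 ⊕ Fin 7 → Fin 7 ⊕ Fin 7 → Bool
  | .inl i, .inl j => j == i + 2 || i == j + 2
  | .inr i, .inr j => j == i + 1 || i == j + 1
  | _, _ => false

theorem full_symm : ∀ p q, Full p q = Full q p := by decide

theorem full_self : ∀ p, Full p p = true := by decide

theorem exists_common_nonneighbors : ∀ p q, p ≠ q → Full p q = true → Linked p q = false →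
    ∃ d e, d ∉ xySupport p ∧ d ∉ xySupport q ∧ e ∉ xySupport p ∧ e ∉ xySupport q ∧ d ≠ e ∧
      ¬ NextTo d e := by
  decide +kernel

theorem private_or_exclusive : ∀ p q, Full p q = false → Linked p q = false →
    PrivatePair (xySupport p) (xySupport q) ∨ PrivatePair (xySupport q) (xySupport p) ∨
      Exclusive (xySupport p) (xySupport q) ∨ Exclusive (xySupport q) (xySupport p) := by
  decide +kernel

theorem linked_distinguishes : ∀ p q, Linked p q = true →
    Distinguishes (xySupport p) (xySupport q) ∧ Distinguishes (xySupport q) (xySupport p) ∧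
      (Full p q = false → PrivateEdge (xySupport p) (xySupport q)) ∧
      (Full p q = true → CommonEdge (xySupport p) (xySupport q)) := by
  decide +kernel

/-- The first alternative arises for `Y_{i-1}`, `Y_i`, `Y_{i+1}`, where the outer two cannot both be
large. The second arises for `X_{i-2}`, `X_i`, `X_{i+2}`, where `d = i + 1` supplies the third leaf
of a claw. -/
theorem linked_linked : ∀ p q, Linked p q = true → ∀ r, Linked p r = true → q ≠ r →
    (Exclusive (xySupport q) (xySupport r) ∨ Exclusive (xySupport r) (xySupport q)) ∨
      Full p q = false ∧ Full p r = false ∧ Full q r = false ∧ Linked q r = false ∧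
        ∃ d, d ∈ xySupport p ∧ d ∉ xySupport q ∧ d ∉ xySupport r := by
  decide +kernel

theorem pieceSupport_injective : Function.Injective pieceSupport := by
  unfold Function.Injective
  decide +kernel

theorem exists_boundary : ∀ p, ∃ d e, d ∈ pieceSupport p ∧ e ∉ pieceSupport p ∧ NextTo d e := by
  decide +kernel

theorem exists_eq_pieceSupport : ∀ S : Finset (Fin 7),
    (∀ j ∈ S, j - 1 ∈ S ∨ j + 1 ∈ S) → (∀ j, ¬ (j ∈ S ∧ j + 2 ∈ S ∧ j + 4 ∈ S)) →
      (∀ j, ¬ (j ∉ S ∧ j + 2 ∉ S ∧ j + 4 ∉ S)) → ∃ p, S = pieceSupport p := by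
  decide +kernel

end Supports

/-- `P` and `Q` record adjacency, or non-adjacency, to two fixed vertices of another piece: one of
the four patterns is excluded and each other occurs at most once. -/
theorem ncard_le_three_of_rows {V : Type*} [Finite V] {S : Set V} (P Q : V → Prop)
    (h11 : ∀ a ∈ S, P a → ¬ Q a)
    (h00 : ∀ a ∈ S, ∀ a' ∈ S, a ≠ a' → ¬ P a → ¬ Q a → ¬ P a' → Q a')
    (h10 : ∀ a ∈ S, ∀ a' ∈ S, a ≠ a' → P a → ¬ Q a → P a' → Q a')
    (h01 : ∀ a ∈ S, ∀ a' ∈ S, a ≠ a' → ¬ P a → Q a → ¬ P a' → ¬ Q a') : S.ncard ≤ 3 := by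
  have h1 : {a ∈ S | ¬ P a ∧ ¬ Q a}.ncard ≤ 1 := by
    refine (Set.ncard_le_one_iff (Set.toFinite _)).2 fun {a a'} ha ha' => ?_
    by_contra hne; exact ha'.2.2 (h00 a ha.1 a' ha'.1 hne ha.2.1 ha.2.2 ha'.2.1)
  have h2 : {a ∈ S | P a ∧ ¬ Q a}.ncard ≤ 1 := by
    refine (Set.ncard_le_one_iff (Set.toFinite _)).2 fun {a a'} ha ha' => ?_
    by_contra hne; exact ha'.2.2 (h10 a ha.1 a' ha'.1 hne ha.2.1 ha.2.2 ha'.2.1)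
  have h3 : {a ∈ S | ¬ P a ∧ Q a}.ncard ≤ 1 := by
    refine (Set.ncard_le_one_iff (Set.toFinite _)).2 fun {a a'} ha ha' => ?_
    by_contra hne; exact h01 a ha.1 a' ha'.1 hne ha.2.1 ha.2.2 ha'.2.1 ha'.2.2
  have hsub : S ⊆ {a ∈ S | ¬ P a ∧ ¬ Q a} ∪ {a ∈ S | P a ∧ ¬ Q a} ∪ {a ∈ S | ¬ P a ∧ Q a} := by
    intro a ha
    have := h11 a ha
    simp only [Set.mem_union, Set.mem_ofPred_eq, ha, true_and]
    tauto
  calc S.ncard ≤ _ := Set.ncard_le_ncard hsub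
    _ ≤ _ := Set.ncard_union_le _ _
    _ ≤ 2 + 1 := add_le_add ((Set.ncard_union_le _ _).trans (add_le_add h1 h2)) h3

/-! ### The 21 pieces: partition, cliques, and interaction of large pieces -/

section Pieces

variable {V : Type*} {G : SimpleGraph V} {φ : SimpleGraph.cycleGraph 7 ↪g G}

theorem holePiece_eq (p : Fin 7 ⊕ Fin 7 ⊕ Fin 7) :
    holePiece φ p = holeClass φ (pieceSupport p : Set (Fin 7)) := by
  rcases p with i | i | i <;>
    simp [holePiece, holeX, holeY, holeZ, pieceSupport, Finset.coe_insert]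

theorem pairwise_disjoint_holePiece :
    Pairwise fun p q => Disjoint (holePiece φ p) (holePiece φ q) := by
  intro p q hpq
  rw [Set.disjoint_left]
  intro v hp hq
  rw [holePiece_eq] at hp hq
  refine hpq (pieceSupport_injective (Finset.ext fun j => ?_))
  exact (hp.2 j).symm.trans (hq.2 j)

theorem isClique_holePiece (hclaw : ¬ claw.IsIndContained G) (p : Fin 7 ⊕ Fin 7 ⊕ Fin 7) :
    G.IsClique (holePiece φ p) := by
  rw [holePiece_eq]
  exact fun u hu v hv huv => adj_of_same_class hclaw hu hv huv (exists_boundary p)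

theorem subsingleton_holeZ (hclaw : ¬ claw.IsIndContained G)
    (hbr : ¬ bridgeGraph.IsIndContained G) (i : Fin 7) : (holeZ φ i).Subsingleton := by
  intro u hu v hv
  by_contra huv
  have hadj : G.Adj u v := isClique_holePiece hclaw (.inr (.inr i)) hu hv huv
  have h : ∀ {w}, w ∈ holeZ φ i → ∀ j ∈ ({i, i + 1, i + 3, i + 4} : Set (Fin 7)),
      G.Adj w (φ j) := fun hw j hj => (hw.2 j).2 hj
  have hn : ∀ i : Fin 7, NextTo i (i + 1) ∧ NextTo (i + 3) (i + 4) ∧ ¬ NextTo i (i + 3) ∧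
      ¬ NextTo i (i + 4) ∧ ¬ NextTo (i + 1) (i + 3) ∧ ¬ NextTo (i + 1) (i + 4) := by decide
  simp only [← hole_adj φ] at hn
  obtain ⟨h1, h2, h3, h4, h5, h6⟩ := hn i
  exact hbr (bridge_isIndContained hadj (h hu i (by simp)) (h hu _ (by simp)) (h hu _ (by simp))
    (h hu _ (by simp)) (h hv i (by simp)) (h hv _ (by simp)) (h hv _ (by simp))
    (h hv _ (by simp)) h1 h2 h3 h4 h5 h6)

theorem iUnion_holePiece (hclaw : ¬ claw.IsIndContained G) (h4 : ¬ fourK1.IsIndContained G) :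
    ⋃ p, holePiece φ p = (Set.range φ)ᶜ := by
  classical
  ext v
  simp only [Set.mem_iUnion, holePiece_eq]
  refine ⟨fun ⟨p, hp⟩ => hp.1, fun hv => ?_⟩
  let S : Finset (Fin 7) := Finset.univ.filter fun j => G.Adj v (φ j)
  have hS : ∀ j, j ∈ S ↔ G.Adj v (φ j) := fun j => by simp [S]
  have hne : ∀ j, φ j ≠ v := fun j h => hv ⟨j, h⟩
  -- Up to rotation, `j, j + 2, j + 4` is the only stable triple of the seven-cycle.
  have hind : ∀ j : Fin 7, ¬ NextTo j (j + 2) ∧ ¬ NextTo j (j + 4) ∧ ¬ NextTo (j + 2) (j + 4) ∧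
      j ≠ j + 2 ∧ j ≠ j + 4 ∧ j + 2 ≠ j + 4 := by decide
  have hside : ∀ j : Fin 7, NextTo j (j - 1) ∧ NextTo j (j + 1) ∧ ¬ NextTo (j - 1) (j + 1) ∧
      j - 1 ≠ j + 1 := by decide
  simp only [← hole_adj φ, ← φ.injective.ne_iff] at hind hside
  obtain ⟨p, hp⟩ := exists_eq_pieceSupport S
    (fun j hj => by
      by_contra! h
      simp only [hS] at h hj
      obtain ⟨s1, s2, s3, s4⟩ := hside j
      exact hclaw (claw_isIndContained s1 s2 hj.symm s3 (fun h' => h.1 h'.symm)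
        (fun h' => h.2 h'.symm) s4 (hne _) (hne _)))
    (fun j ⟨h1, h2, h3⟩ => by
      rw [hS] at h1 h2 h3
      obtain ⟨s1, s2, s3, s4, s5, s6⟩ := hind j
      exact hclaw (claw_isIndContained h1 h2 h3 s1 s2 s3 s4 s5 s6))
    (fun j ⟨h1, h2, h3⟩ => by
      rw [hS] at h1 h2 h3
      obtain ⟨s1, s2, s3, s4, s5, s6⟩ := hind j
      exact h4 (fourK1_isIndContained h1 h2 h3 s1 s2 s3 (hne _).symm (hne _).symm (hne _).symm
        s4 s5 s6))
  exact ⟨p, hv, fun j => by rw [← hp, Finset.mem_coe, hS]⟩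

/-- The pieces `X_i` and `Y_i`. -/
def holeXY (φ : SimpleGraph.cycleGraph 7 ↪g G) (p : Fin 7 ⊕ Fin 7) : Set V :=
  holeClass φ (xySupport p : Set (Fin 7))

variable {p q r : Fin 7 ⊕ Fin 7} {u v w : V}

theorem adj_of_mem_holeXY (hclaw : ¬ claw.IsIndContained G) (hu : u ∈ holeXY φ p)
    (hv : v ∈ holeXY φ p) (huv : u ≠ v) : G.Adj u v :=
  adj_of_same_class hclaw hu hv huv (exists_boundary _)

theorem ncard_le_three_of_exclusive [Finite V] (hclaw : ¬ claw.IsIndContained G)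
    (hbr : ¬ bridgeGraph.IsIndContained G) (hq : 4 ≤ (holeXY φ q).ncard)
    (h : Exclusive (xySupport p) (xySupport q)) : (holeXY φ p).ncard ≤ 3 := by
  obtain ⟨b, hb, b', hb', hbb⟩ := (Set.one_lt_ncard (s := holeXY φ q)).1 (by omega)
  have hadj := adj_of_mem_holeXY hclaw hb hb' hbb
  have hp : ∀ {a a'}, a ∈ holeXY φ p → a' ∈ holeXY φ p → a ≠ a' → G.Adj a a' :=
    fun h h' => adj_of_mem_holeXY hclaw h h'
  refine ncard_le_three_of_rows (fun a => G.Adj a b) (fun a => G.Adj a b') ?_ ?_ ?_ ?_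
  · exact fun a ha => not_adj_both hbr ha hb hb' hadj h
  · exact fun a ha a' ha' hne => not_both_empty hbr ha ha' hb hb' (hp ha ha' hne) hadj h.2.1
  · intro a ha a' ha' hne h1 h2 h3
    by_contra h4
    exact not_distinguished hbr ha ha' hb' hb (hp ha ha' hne) hadj.symm h.1 h2 h1 h4 h3
  · exact fun a ha a' ha' hne => not_distinguished hbr ha ha' hb hb' (hp ha ha' hne) hadj h.1

theorem adj_iff_full [Finite V] (hclaw : ¬ claw.IsIndContained G)
    (h4 : ¬ fourK1.IsIndContained G) (hbr : ¬ bridgeGraph.IsIndContained G)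
    (hp : 4 ≤ (holeXY φ p).ncard) (hq : 4 ≤ (holeXY φ q).ncard) (hpq : Linked p q = false)
    (hu : u ∈ holeXY φ p) (hv : v ∈ holeXY φ q) (huv : u ≠ v) :
    G.Adj u v ↔ Full p q = true := by
  rcases eq_or_ne p q with rfl | hne
  · simp [full_self, adj_of_mem_holeXY hclaw hu hv huv]
  cases hF : Full p q with
  | true =>
    simpa using adj_of_common_nonneighbors h4 hu hv huv (exists_common_nonneighbors p q hne hF hpq)
  | false =>
    simp only [Bool.false_eq_true, iff_false]
    rcases private_or_exclusive p q hF hpq with h | h | h | h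
    · exact not_adj_of_private_neighbors hclaw hu hv h
    · exact fun h' => not_adj_of_private_neighbors hclaw hv hu h h'.symm
    · have := ncard_le_three_of_exclusive hclaw hbr hq h
      omega
    · have := ncard_le_three_of_exclusive hclaw hbr hp h
      omega

theorem eq_of_linked [Finite V] (hclaw : ¬ claw.IsIndContained G)
    (hbr : ¬ bridgeGraph.IsIndContained G)
    (hp : 4 ≤ (holeXY φ p).ncard) (hpq : Linked p q = true)
    (hu : u ∈ holeXY φ p) (hv : v ∈ holeXY φ q) (hw : w ∈ holeXY φ q)
    (huv : ¬ (G.Adj u v ↔ Full p q = true)) (huw : ¬ (G.Adj u w ↔ Full p q = true)) : v = w := by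
  by_contra hvw
  have hadj := adj_of_mem_holeXY hclaw hv hw hvw
  have hpp : ∀ {a a'}, a ∈ holeXY φ p → a' ∈ holeXY φ p → a ≠ a' → G.Adj a a' :=
    fun h h' => adj_of_mem_holeXY hclaw h h'
  obtain ⟨h1, h2, h3, h5⟩ := linked_distinguishes p q hpq
  suffices (holeXY φ p).ncard ≤ 3 by omega
  cases hF : Full p q with
  | true =>
    simp only [hF, iff_true] at huv huw
    refine ncard_le_three_of_rows (fun a => G.Adj a v) (fun a => G.Adj a w) ?_ ?_ ?_ ?_
    -- Here the roles swap: `v` and `w` both miss `u` and both see `a`, which is what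
    -- `not_distinguished` forbids.
    · intro a ha hav haw
      have hne : u ≠ a := by rintro rfl; exact huv hav
      exact not_distinguished hbr hv hw hu ha hadj (hpp hu ha hne) h2 (fun h => huv h.symm)
        hav.symm (fun h => huw h.symm) haw.symm
    · exact fun a ha a' ha' hne => not_both_empty hbr ha ha' hv hw (hpp ha ha' hne) hadj (h5 hF)
    · intro a ha a' ha' hne e1 e2 e3
      by_contra e4
      exact not_distinguished hbr ha ha' hw hv (hpp ha ha' hne) hadj.symm h1 e2 e1 e4 e3
    · exact fun a ha a' ha' hne => not_distinguished hbr ha ha' hv hw (hpp ha ha' hne) hadj h1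
  | false =>
    simp only [hF, Bool.false_eq_true, iff_false, not_not] at huv huw
    -- The same count with adjacency complemented, since deviations are now edges.
    refine ncard_le_three_of_rows (fun a => ¬ G.Adj a v) (fun a => ¬ G.Adj a w) ?_ ?_ ?_ ?_
    · intro a ha hav haw
      have hne : a ≠ u := by rintro rfl; exact hav huv
      exact not_distinguished hbr hv hw ha hu hadj (hpp ha hu hne) h2 (fun h => hav h.symm)
        huv.symm (fun h => haw h.symm) huw.symm
    · intro a ha a' ha' hne e1 e2 e3
      rw [not_not] at e1 e2 e3
      exact not_both_full hbr ha ha' hv hw (hpp ha ha' hne) hadj (h3 hF) e1 e2 e3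
    · intro a ha a' ha' hne e1 e2 e3
      exact not_distinguished hbr ha ha' hv hw (hpp ha ha' hne) hadj h1 e1 (not_not.1 e2) e3
    · intro a ha a' ha' hne e1 e2 e3 e4
      exact not_distinguished hbr ha ha' hw hv (hpp ha ha' hne) hadj.symm h1 e2 (not_not.1 e1) e4
        (not_not.1 e3)

theorem eq_of_residual [Finite V] (hclaw : ¬ claw.IsIndContained G)
    (h4 : ¬ fourK1.IsIndContained G) (hbr : ¬ bridgeGraph.IsIndContained G)
    (hp : 4 ≤ (holeXY φ p).ncard) (hq : 4 ≤ (holeXY φ q).ncard) (hr : 4 ≤ (holeXY φ r).ncard)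
    (hu : u ∈ holeXY φ p) (hv : v ∈ holeXY φ q) (hw : w ∈ holeXY φ r) (nuv : u ≠ v)
    (nuw : u ≠ w) (huv : ¬ (G.Adj u v ↔ Full p q = true))
    (huw : ¬ (G.Adj u w ↔ Full p r = true)) : v = w := by
  have hpq : Linked p q = true := by
    by_contra h
    exact huv (adj_iff_full hclaw h4 hbr hp hq (by simpa using h) hu hv nuv)
  have hpr : Linked p r = true := by
    by_contra h
    exact huw (adj_iff_full hclaw h4 hbr hp hr (by simpa using h) hu hw nuw)
  rcases eq_or_ne q r with rfl | hqr
  · exact eq_of_linked hclaw hbr hp hpq hu hv hw huv huw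
  by_contra nvw
  rcases linked_linked p q hpq r hpr hqr with (h | h) | ⟨e1, e2, e3, e4, h⟩
  · have := ncard_le_three_of_exclusive hclaw hbr hr h
    omega
  · have := ncard_le_three_of_exclusive hclaw hbr hq h
    omega
  · simp only [e1, e2, Bool.false_eq_true, iff_false, not_not] at huv huw
    have hvw := adj_iff_full hclaw h4 hbr hq hr e4 hv hw nvw
    rw [e3] at hvw
    exact not_adj_of_star hclaw hu hv hw nvw (by simp [hvw]) h huv huw

/-- Few vertices lie outside of the large pieces. -/
theorem ncard_small_le [Finite V] (hclaw : ¬ claw.IsIndContained G)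
    (h4 : ¬ fourK1.IsIndContained G) (hbr : ¬ bridgeGraph.IsIndContained G) :
    {v | ¬ ∃ p, v ∈ holeXY φ p ∧ 4 ≤ (holeXY φ p).ncard}.ncard ≤ 70 := by
  set S := {v | ¬ ∃ p, v ∈ holeXY φ p ∧ 4 ≤ (holeXY φ p).ncard} with hS
  have hsub : S ⊆ Set.range φ ∪ ⋃ p, S ∩ holePiece φ p := by
    intro v hv
    by_cases h : v ∈ Set.range φ
    · exact .inl h
    · rw [← Set.mem_compl_iff, ← iUnion_holePiece hclaw h4, Set.mem_iUnion] at h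
      obtain ⟨p, hp⟩ := h
      exact .inr (Set.mem_iUnion.2 ⟨p, hv, hp⟩)
  have hXY : ∀ p : Fin 7 ⊕ Fin 7, (S ∩ holePiece φ (p.map id .inl)).ncard ≤ 3 := by
    intro p
    rw [holePiece_eq]
    change (S ∩ holeXY φ p).ncard ≤ 3
    by_cases h : 4 ≤ (holeXY φ p).ncard
    · rw [Set.eq_empty_of_forall_notMem (s := S ∩ holeXY φ p) fun v hv => hv.1 ⟨p, hv.2, h⟩]
      simp
    · exact (Set.ncard_le_ncard Set.inter_subset_right).trans (by omega)
  have h3 : ∀ p, (S ∩ holePiece φ p).ncard ≤ 3 := by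
    rintro (i | i | i)
    · exact hXY (.inl i)
    · exact hXY (.inr i)
    · refine le_trans ((Set.ncard_le_one_iff (Set.toFinite _)).2 ?_) (by norm_num : 1 ≤ 3)
      exact fun {u v} hu hv => subsingleton_holeZ hclaw hbr i hu.2 hv.2
  have hrange : (Set.range φ).ncard = 7 := by
    rw [← Nat.card_coe_set_eq, Nat.card_range_of_injective φ.injective]
    simp
  calc S.ncard ≤ _ := Set.ncard_le_ncard hsub
    _ ≤ _ := Set.ncard_union_le _ _
    _ ≤ 7 + ∑ p : Fin 7 ⊕ Fin 7 ⊕ Fin 7, 3 := by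
      refine add_le_add hrange.le ((Set.ncard_iUnion_le_of_fintype _).trans ?_)
      exact Finset.sum_le_sum fun p _ => h3 p
    _ = 70 := by simp

end Pieces

theorem mainTheorem5 :
    ∃ k : ℕ, ∀ (V : Type*) [Finite V] (G : SimpleGraph V),
      ¬ claw.IsIndContained G → ¬ fourK1.IsIndContained G → ¬ bridgeGraph.IsIndContained G →
      (SimpleGraph.cycleGraph 7).IsIndContained G →
        cliqueWidth G ≤ k ∧
        ∀ φ : SimpleGraph.cycleGraph 7 ↪g G,
          (⋃ p, holePiece φ p) = (Set.range φ)ᶜ ∧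
          Pairwise (fun p q => Disjoint (holePiece φ p) (holePiece φ q)) ∧
          (∀ p, G.IsClique (holePiece φ p)) ∧
          ∀ i, (holeZ φ i).Subsingleton := by
  classical
  obtain ⟨k, hk⟩ := exists_bound_cliqueWidth 70 (Fin 7 ⊕ Fin 7)
  refine ⟨k, fun V _ G hclaw h4 hbr hC => ⟨?_, fun φ => ⟨iUnion_holePiece hclaw h4,
    pairwise_disjoint_holePiece, isClique_holePiece hclaw, subsingleton_holeZ hclaw hbr⟩⟩⟩
  obtain ⟨φ⟩ := hC
  have : Nonempty V := ⟨φ 0⟩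
  -- The default `.inl 0` is taken only on the exceptional set, where the class is never consulted.
  let cls : V → Fin 7 ⊕ Fin 7 := fun v =>
    if h : ∃ p, v ∈ holeXY φ p ∧ 4 ≤ (holeXY φ p).ncard then h.choose else .inl 0
  refine hk V G {v | ¬ ∃ p, v ∈ holeXY φ p ∧ 4 ≤ (holeXY φ p).ncard} cls
    (fun p q => Full p q = true) (ncard_small_le hclaw h4 hbr) ?_
    fun p q h => by rwa [full_symm]
  have hcls : ∀ v, v ∉ {v | ¬ ∃ p, v ∈ holeXY φ p ∧ 4 ≤ (holeXY φ p).ncard} →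
      v ∈ holeXY φ (cls v) ∧ 4 ≤ (holeXY φ (cls v)).ncard := by
    intro v hv
    have h := not_not.1 hv
    simp only [cls, dif_pos h]
    exact h.choose_spec
  intro u hu v hv w hw nuv nuw huv huw
  exact eq_of_residual hclaw h4 hbr (hcls u hu).2 (hcls v hv).2 (hcls w hw).2 (hcls u hu).1
    (hcls v hv).1 (hcls w hw).1 nuv nuw huv huw
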